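/- Let $n\ge 3$ and $m\ge 3$, let $N=\{1,\dots,n\}$ be the set of individuals and let $X$ be a set of $m+1$ alternatives. An ordering is a complete, asymmetric, transitive relation, and a profile $p$ assigns an ordering $\succ_{p(i)}$ to each $i\in N$. For a finite set $Y$ of $k$ alternatives, $NP(n,k)$ over $Y$ is the set of all profiles $p$ of orderings on $Y$ such that for any two distinct $x,y\in Y$ there are $i,j\in N$ with $x\succ_{p(i)}y$ and $y\succ_{p(j)}x$. A rule $g$ on $NP(n,k)$ over $Y$ is a function from $NP(n,k)$ to $Y$; it has full range if its range is $Y$, and it is strategy-proof if there are no $h\in N$ and $p,p'\in NP(n,k)$ with $p'(i)=p(i)$ for all $i\neq h$ and $g(p')\succ_{p(h)}g(p)$. Let $g$ be a strategy-proof rule on $NP(n,m+1)$ over $X$ with full range $X$. Let $w,z\in X$ be distinct, let $x^*\notin X$, and put $X^*=\{x^*\}\cup X\setminus\{w,z\}$. For each $p\in NP(n,m)$ over $X^*$ choose a profile $r\in NP(n,m+1)$ over $X$ such that, for every $i\in N$, $w$ and $z$ are contiguous in $r(i)$ (no alternative ranks strictly between them), the restrictions of $r(i)$ and $p(i)$ to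 $X\setminus\{w,z\}$ coincide, and $$\{x\in X\setminus\{w,z\}: x\succ_{r(i)}w\}=\{x\in X\setminus\{w,z\}: x\succ_{p(i)}x^*\}.$$ (Such an $r$ always exists.) Define $g^*(p)=x^*$ if $g(r)\in\{w,z\}$, and $g^*(p)=g(r)$ otherwise. Then, however the profiles $r$ are chosen, the rule $g^*$ on $NP(n,m)$ over $X^*$ has full range: $\mathrm{Range}(g^*)=X^*$. -/

import Mathlib

/-- A (strong) ordering on `X`: a complete, asymmetric, transitive relation.
`R.pref a b` means that `a` is ranked above `b`. -/
structure StrongOrdering (X : Type*) where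
  pref : X → X → Prop
  complete : ∀ a b, a ≠ b → pref a b ∨ pref b a
  asymm : ∀ a b, pref a b → ¬ pref b a
  trans : ∀ a b c, pref a b → pref b c → pref a c

/-- A profile assigns an ordering to each of the `n` individuals. -/
abbrev Profile (n : ℕ) (X : Type*) := Fin n → StrongOrdering X

/-- The Non-Paretian domain: for any two distinct alternatives `x`, `y`, somebody ranks `x` above
`y` and somebody ranks `y` above `x`. -/
def NP (n : ℕ) (X : Type*) : Set (Profile n X) :=
  {p | ∀ x y : X, x ≠ y → (∃ i, (p i).pref x y) ∧ ∃ j, (p j).pref y x}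

/-- `p` and `q` agree for all individuals other than `h`. -/
def IsVariant {n : ℕ} {X : Type*} (h : Fin n) (p q : Profile n X) : Prop :=
  ∀ i, i ≠ h → q i = p i

/-- Individual `h` can manipulate the rule `g` at `p` via `p'`. -/
def CanManipulate {n : ℕ} {X : Type*} {D : Set (Profile n X)} (g : D → X) (h : Fin n)
    (p p' : D) : Prop :=
  IsVariant h p.1 p'.1 ∧ (p.1 h).pref (g p') (g p)

/-- A rule on a domain `D` is strategy-proof if no one can manipulate it at any profile of `D`. -/
def StrategyProof {n : ℕ} {X : Type*} {D : Set (Profile n X)} (g : D → X) : Prop :=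
  ∀ (h : Fin n) (p p' : D), ¬ CanManipulate g h p p'

/-- A rule is of full range if its range is the whole set of alternatives. -/
def FullRange {n : ℕ} {X : Type*} {D : Set (Profile n X)} (g : D → X) : Prop :=
  Set.range g = Set.univ

/-- `X \ {w, z}`. -/
abbrev Others {X : Type*} (w z : X) := {y : X // y ≠ w ∧ y ≠ z}

/-- `X* = {x*} ∪ X \ {w, z}`, where `x* = none` is a new alternative. -/
abbrev Merged {X : Type*} (w z : X) := Option (Others w z)

open Classical in
/-- The map `X → X*` that sends `w` and `z` to `x*` and fixes every other alternative. -/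
noncomputable def merge {X : Type*} (w z : X) (a : X) : Merged w z :=
  if h : a ≠ w ∧ a ≠ z then some ⟨a, h⟩ else none

/-- `a` and `b` are contiguous in `R`: no alternative ranks strictly between them. -/
def Contiguous {X : Type*} (R : StrongOrdering X) (a b : X) : Prop :=
  ¬ ∃ y, (R.pref a y ∧ R.pref y b) ∨ (R.pref b y ∧ R.pref y a)

/-- The profiles of `NP` at which `w` and `z` are contiguous in each individual ordering. -/
def NPContiguous (n : ℕ) {X : Type*} (w z : X) : Set (Profile n X) :=
  {r | r ∈ NP n X ∧ ∀ i, Contiguous (r i) w z}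

/-- `r` arises from the profile `p` on `X*` by replacing `x*` by `w` and `z`: `r` belongs to `NP`,
with `w` and `z` contiguous everywhere, `r` and `p` have the same restriction to `X \ {w, z}`, and
the same members of `X \ {w, z}` rank above `w` in `r i` as rank above `x*` in `p i`. -/
def IsSplitting {n : ℕ} {X : Type*} {w z : X} (p : Profile n (Merged w z)) (r : Profile n X) :
    Prop :=
  r ∈ NPContiguous n w z ∧
  (∀ i, ∀ a b : Others w z, (r i).pref a b ↔ (p i).pref (some a) (some b)) ∧
  (∀ i, {a : Others w z | (r i).pref a w} = {a : Others w z | (p i).pref (some a) none})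

/-- The rule `g*` on `NP` over `X*` that is induced by `g`, where `r p` is the splitting that is
chosen for `p`: `g* p` is `x*` if `g` selects `w` or `z` at `r p`, and otherwise it is the
alternative that `g` selects at `r p`. -/
noncomputable def inducedRule {n : ℕ} {X : Type*} {w z : X} (g : NP n X → X)
    (r : (p : NP n (Merged w z)) → {r : Profile n X // IsSplitting p.1 r}) :
    NP n (Merged w z) → Merged w z :=
  fun p => merge w z (g ⟨(r p).1, (r p).2.1.1⟩)

theorem merge_eq {X : Type*} {w z a b : X} (h : merge w z a = merge w z b) :
    a = b ∨ ((a = w ∨ a = z) ∧ (b = w ∨ b = z)) := by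
  unfold merge at h
  split_ifs at h with h1 h2 h2
  · left; simpa using h
  · right; tauto

/-- With at least two individuals, every profile of `NP` over `X*` has a splitting, so that the
choice in `inducedRule` can always be made. -/
theorem exists_isSplitting {n : ℕ} (hn : 2 ≤ n) {X : Type*} {w z : X} (hwz : w ≠ z)
    (p : NP n (Merged w z)) : ∃ r : Profile n X, IsSplitting p.1 r := by
  obtain ⟨p, hp⟩ := p
  have irr : ∀ i a, ¬ (p i).pref a a := fun i a h => (p i).asymm a a h h
  have mw : merge w z w = none := by simp [merge]
  have mz : merge w z z = none := by simp [merge]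
  have mo : ∀ a : Others w z, merge w z a = some a := fun a => by simp [merge, a.2.1, a.2.2]
  let i0 : Fin n := ⟨0, by omega⟩
  let i1 : Fin n := ⟨1, by omega⟩
  have h10 : i1 ≠ i0 := by simp [i0, i1]
  let T : Fin n → X → X → Prop := fun i a b =>
    (i = i0 ∧ a = w ∧ b = z) ∨ (i ≠ i0 ∧ a = z ∧ b = w)
  have hT : ∀ i a b, T i a b → merge w z a = merge w z b := by
    rintro i a b (⟨-, rfl, rfl⟩ | ⟨-, rfl, rfl⟩) <;> rw [mw, mz]
  let r : Profile n X := fun i =>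
    { pref := fun a b => (p i).pref (merge w z a) (merge w z b) ∨ T i a b
      complete := by
        intro a b hab
        by_cases h : merge w z a = merge w z b
        · have := merge_eq h
          simp only [T]
          by_cases hi : i = i0 <;> grind
        · rcases (p i).complete _ _ h with h | h <;> tauto
      asymm := by
        rintro a b (h | h) (h' | h')
        · exact (p i).asymm _ _ h h'
        · rw [hT _ _ _ h'] at h; exact irr _ _ h
        · rw [hT _ _ _ h] at h'; exact irr _ _ h'
        · simp only [T] at h h'; grind
      trans := by
        rintro a b c (h | h) (h' | h')
        · exact Or.inl ((p i).trans _ _ _ h h')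
        · rw [hT _ _ _ h'] at h; exact Or.inl h
        · rw [← hT _ _ _ h] at h'; exact Or.inl h'
        · simp only [T] at h h'; grind }
  have hr : ∀ i a b, (r i).pref a b ↔ (p i).pref (merge w z a) (merge w z b) ∨ T i a b :=
    fun _ _ _ => Iff.rfl
  refine ⟨r, ⟨?_, ?_⟩, ?_, ?_⟩
  · intro a b hab
    by_cases h : merge w z a = merge w z b
    · have key : (a = w ∧ b = z) ∨ (a = z ∧ b = w) := by
        have := merge_eq h
        grind
      rcases key with ⟨rfl, rfl⟩ | ⟨rfl, rfl⟩
      · exact ⟨⟨i0, Or.inr (Or.inl ⟨rfl, rfl, rfl⟩)⟩, ⟨i1, Or.inr (Or.inr ⟨h10, rfl, rfl⟩)⟩⟩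
      · exact ⟨⟨i1, Or.inr (Or.inr ⟨h10, rfl, rfl⟩)⟩, ⟨i0, Or.inr (Or.inl ⟨rfl, rfl, rfl⟩)⟩⟩
    · obtain ⟨⟨i, hi⟩, ⟨j, hj⟩⟩ := hp _ _ h
      exact ⟨⟨i, Or.inl hi⟩, ⟨j, Or.inl hj⟩⟩
  · rintro i ⟨y, h⟩
    simp only [hr, mw, mz] at h
    have A := (p i).asymm none (merge w z y)
    simp only [T] at h
    grind
  · intro i a b
    have := a.2
    rw [hr, mo, mo]
    simp only [T]
    grind
  · intro i
    ext a
    have := a.2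
    simp only [Set.mem_ofPred_eq, hr, mo, mw, T]
    grind

/-!
Call the individuals who rank `y` above `x` the supporters of `y` against `x`.

On the Non-Paretian domain with at least three individuals, a strategy-proof rule is monotone
(`StrategyProof.monotone`): if it selects `x` at `p`, it selects `x` at every profile of `NP` at
which no alternative has gained a supporter against `x`. A change by a single individual preserves
the outcome by strategy-proofness, so the point is to join two profiles by such changes without
leaving `NP`. Suppose first that the supporters against `x` are the same at both. Sorting each
individual's alternatives above `x`, and those below `x`, by their numbers of supporters stays
within `NP` (`piecewise_arrange_mem_NP`). Once sorted, every profile of `NP` may be used to break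
ties (`arrange_card_mem_NP`), and `NP` is connected by changes of one individual's ordering
(`NP_connected`). Losses of supporters are then handled for one individual at a time
(`StrategyProof.eq_of_upperSet_erase`).

The second ingredient is that each `x` other than `w`, `z` is selected at a profile in which some
individual ranks both `w` and `z` above `x` (`StrategyProof.exists_common_supporter`). Otherwise,
by monotonicity, `x` is selected at a profile where one individual reports `w x z`, another `z x w`,
and all others `x w z`. If the second changes to `z w x`, the outcome becomes `w`; if the first
changes to `w z x`, it becomes `z`. If both change, the outcome has to be both `w` and `z`.

Now let this individual be the only supporter of `x*` against `x`, with the supporters of the other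
alternatives unchanged. Some `p` in `NP` over `X*` has these supporters, and at any splitting of `p`
the rule selects `x` by monotonicity (`inducedRule_eq_some`). For `x*`, take a profile at which `g`
selects `w`, and a `p` with the same supporters against `x*`. If `g` selected some `x` outside
`{w, z}` at the chosen splitting of `p`, it would do so at every splitting, since the supporters
against `x` are the same; but at the splitting that ranks `w` and `z` as the original profile does,
it selects `w` (`inducedRule_eq_none`).
-/

/-! ### Orderings -/

namespace StrongOrdering

variable {X Y : Type*}

theorem irrefl (R : StrongOrdering X) (a : X) : ¬ R.pref a a := fun h => R.asymm a a h h

theorem not_pref_iff (R : StrongOrdering X) {a b : X} (hab : a ≠ b) :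
    ¬ R.pref a b ↔ R.pref b a :=
  ⟨fun h => (R.complete a b hab).resolve_left h, fun h => R.asymm _ _ h⟩

/-- The reverse ordering. -/
def reverse (R : StrongOrdering X) : StrongOrdering X where
  pref a b := R.pref b a
  complete a b hab := (R.complete a b hab).symm
  asymm _ _ := R.asymm _ _
  trans a b c h h' := R.trans c b a h' h

/-- The ordering that is pulled back along an injection. -/
def comap (R : StrongOrdering Y) (f : X → Y) (hf : Function.Injective f) : StrongOrdering X where
  pref a b := R.pref (f a) (f b)
  complete _ _ hab := R.complete _ _ (hf.ne hab)
  asymm _ _ := R.asymm _ _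
  trans _ _ _ := R.trans _ _ _

/-- The ordering that compares the images under `f` by `S`, and breaks ties by `R`. -/
def lex (S : StrongOrdering Y) (f : X → Y) (R : StrongOrdering X) : StrongOrdering X where
  pref a b := S.pref (f a) (f b) ∨ f a = f b ∧ R.pref a b
  complete a b hab := by
    by_cases h : f a = f b
    · rcases R.complete a b hab with h' | h'
      · exact Or.inl (Or.inr ⟨h, h'⟩)
      · exact Or.inr (Or.inr ⟨h.symm, h'⟩)
    · exact (S.complete _ _ h).imp Or.inl Or.inl
  asymm := by
    rintro a b (h | ⟨h, h1⟩) (h' | ⟨h', h2⟩)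
    · exact S.asymm _ _ h h'
    · exact S.irrefl _ (h' ▸ h)
    · exact S.irrefl _ (h ▸ h')
    · exact R.asymm _ _ h1 h2
  trans := by
    rintro a b c (h | ⟨h, h1⟩) (h' | ⟨h', h2⟩)
    · exact Or.inl (S.trans _ _ _ h h')
    · exact Or.inl (h' ▸ h)
    · exact Or.inl (h ▸ h')
    · exact Or.inr ⟨h.trans h', R.trans _ _ _ h1 h2⟩

/-- The stable sort of `R` by the key `k`: a smaller key ranks higher, and `R` breaks ties. -/
def sortBy (k : X → ℕ) (R : StrongOrdering X) : StrongOrdering X :=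
  lex ⟨(· < ·), fun _ _ => lt_or_gt_of_ne, fun _ _ => lt_asymm, fun _ _ _ => lt_trans⟩ k R

theorem sortBy_pref {k : X → ℕ} {R : StrongOrdering X} {a b : X} :
    (sortBy k R).pref a b ↔ k a < k b ∨ k a = k b ∧ R.pref a b :=
  Iff.rfl

end StrongOrdering

/-! ### Connectedness of the Non-Paretian domain -/

section Connectedness

variable {n : ℕ} {X : Type*}

theorem IsVariant.symm {h : Fin n} {p q : Profile n X} (hpq : IsVariant h p q) :
    IsVariant h q p :=
  fun i hi => (hpq i hi).symm

theorem isVariant_update (p : Profile n X) (h : Fin n) (R : StrongOrdering X) :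
    IsVariant h p (Function.update p h R) :=
  fun _ hi => Function.update_of_ne hi _ _

theorem mem_NP_of_forall_exists {p : Profile n X} (hp : ∀ x y, x ≠ y → ∃ i, (p i).pref x y) :
    p ∈ NP n X :=
  fun x y hxy => ⟨hp x y hxy, hp y x hxy.symm⟩

/-- Two individuals with opposite orderings suffice for membership in `NP`. -/
theorem mem_NP_of_reverse {p : Profile n X} (i j : Fin n) (h : p j = (p i).reverse) :
    p ∈ NP n X := by
  refine mem_NP_of_forall_exists fun x y hxy => ?_
  rcases (p i).complete x y hxy with h' | h'
  · exact ⟨i, h'⟩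
  · exact ⟨j, by rw [h]; exact h'⟩

/-- With at least three individuals, `NP` is connected by changes of a single individual's ordering:
while two individuals have opposite orderings, the others are free to change. -/
theorem NP_connected (hn : 3 ≤ n) {Φ : Profile n X → Prop}
    (step : ∀ h p p', p ∈ NP n X → p' ∈ NP n X → IsVariant h p p' → Φ p → Φ p')
    {p p' : Profile n X} (hp : p ∈ NP n X) (hp' : p' ∈ NP n X) (h : Φ p) : Φ p' := by
  let a : Fin n := ⟨0, by omega⟩
  let b : Fin n := ⟨1, by omega⟩
  let c : Fin n := ⟨2, by omega⟩
  have hab : a ≠ b := by simp [a, b]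
  have hac : a ≠ c := by simp [a, c]
  have hbc : b ≠ c := by simp [b, c]
  -- Individual `c` is first set against `a`, which frees all others; once `b` has switched, `c` is
  -- set against `b`, which frees `a`; then `c` switches.
  let q0 := Function.update p c (p a).reverse
  have hq0 : Φ q0 := step c p _ hp
    (mem_NP_of_reverse a c (by simp [q0, hac])) (isVariant_update _ _ _) h
  have key : ∀ S : Finset (Fin n), a ∉ S → c ∉ S → Φ (S.piecewise p' q0) := by
    intro S
    induction S using Finset.induction_on with
    | empty => intro _ _; simpa using hq0
    | insert i S hi ih =>
      intro haS hcS
      have haS' : a ∉ S := fun hh => haS (Finset.mem_insert_of_mem hh)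
      have hcS' : c ∉ S := fun hh => hcS (Finset.mem_insert_of_mem hh)
      refine step i _ _ ?_ ?_ ?_ (ih haS' hcS')
      · exact mem_NP_of_reverse a c (by simp [haS', hcS', q0, hac])
      · exact mem_NP_of_reverse a c (by
          rw [Finset.piecewise_eq_of_notMem _ _ _ haS, Finset.piecewise_eq_of_notMem _ _ _ hcS]
          simp [q0, hac])
      · rw [Finset.piecewise_insert]
        exact isVariant_update _ _ _
  have h1 := key {i | i ≠ a ∧ i ≠ c} (by simp) (by simp)
  let q1 := Finset.piecewise {i | i ≠ a ∧ i ≠ c} p' q0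
  have q1a : q1 a = p a := by simp [q1, q0, hac]
  have q1c : q1 c = (p a).reverse := by simp [q1, q0]
  have q1i : ∀ i, i ≠ a → i ≠ c → q1 i = p' i := fun i hia hic => by simp [q1, hia, hic]
  have q1NP : q1 ∈ NP n X := mem_NP_of_reverse a c (by rw [q1a, q1c])
  let q2 := Function.update q1 c (p' b).reverse
  have q2NP : q2 ∈ NP n X := mem_NP_of_reverse b c (by
    simp [q2, hbc, q1i b hab.symm hbc])
  have h2 : Φ q2 := step c _ _ q1NP q2NP (isVariant_update _ _ _) h1
  let q3 := Function.update q2 a (p' a)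
  have q3NP : q3 ∈ NP n X := mem_NP_of_reverse b c (by
    simp [q3, q2, hbc, hab.symm, hac.symm, q1i b hab.symm hbc])
  have h3 : Φ q3 := step a _ _ q2NP q3NP (isVariant_update _ _ _) h2
  refine step c _ _ q3NP hp' (fun i hi => ?_) h3
  by_cases hia : i = a
  · subst hia; simp [q3]
  · simp [q3, q2, hia, hi, q1i i hia hi]

end Connectedness

/-! ### Strategy-proof rules are monotone -/

section Monotonicity

variable {n : ℕ} {X : Type*} {g : NP n X → X}

open Classical in
/-- The set of individuals who rank `y` above `x`. -/
noncomputable def upperSet {n : ℕ} {X : Type*} (p : Profile n X) (x y : X) : Finset (Fin n) :=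
  Finset.univ.filter fun i => (p i).pref y x

theorem mem_upperSet {n : ℕ} {X : Type*} {p : Profile n X} {x y : X} {i : Fin n} :
    i ∈ upperSet p x y ↔ (p i).pref y x := by
  simp [upperSet]

/-- An individual who changes the outcome prefers the old outcome by the old ordering, and the new
outcome by the new one. -/
theorem StrategyProof.pref_of_isVariant (hg : StrategyProof g) {h : Fin n} {p p' : NP n X}
    (hv : IsVariant h p.1 p'.1) (hne : g p' ≠ g p) :
    (p.1 h).pref (g p) (g p') ∧ (p'.1 h).pref (g p') (g p) :=
  ⟨((p.1 h).not_pref_iff hne).1 fun hh => hg h p p' ⟨hv, hh⟩,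
    ((p'.1 h).not_pref_iff hne.symm).1 fun hh => hg h p' p ⟨hv.symm, hh⟩⟩

theorem StrategyProof.eq_of_isVariant (hg : StrategyProof g) {h : Fin n} {p p' : NP n X}
    {x : X} (hv : IsVariant h p.1 p'.1) (hU : ∀ y, (p'.1 h).pref y x → (p.1 h).pref y x)
    (hx : g p = x) : g p' = x := by
  subst hx
  by_contra hne
  obtain ⟨h1, h2⟩ := hg.pref_of_isVariant hv hne
  exact (p.1 h).asymm _ _ h1 (hU _ h2)

/-- The outcome `x` is kept when the individuals switch one after the other to orderings with no more
alternatives above `x`, provided that all the profiles on the way belong to `NP`. -/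
theorem StrategyProof.eq_of_piecewise (hg : StrategyProof g) {x : X} {p p' : Profile n X}
    (hNP : ∀ S : Finset (Fin n), S.piecewise p' p ∈ NP n X)
    (hU : ∀ i y, (p' i).pref y x → (p i).pref y x) (hp : p ∈ NP n X) (hp' : p' ∈ NP n X)
    (h : g ⟨p, hp⟩ = x) : g ⟨p', hp'⟩ = x := by
  have key : ∀ S : Finset (Fin n), g ⟨_, hNP S⟩ = x := by
    intro S
    induction S using Finset.induction_on with
    | empty => simpa using h
    | insert i S hi ih =>
      refine hg.eq_of_isVariant (h := i) ?_ (fun y hy => ?_) ih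
      · simp only [Finset.piecewise_insert]
        exact isVariant_update _ _ _
      · simp only [Finset.piecewise_insert_self] at hy
        simp only [Finset.piecewise_eq_of_notMem _ _ _ hi]
        exact hU i y hy
  have := key Finset.univ
  simpa using this

open Classical in
/-- The profile in which exactly the individuals of `t y` rank `y` above `x`; above `x` and below
`x`, alternatives are ranked by increasing `c`, and ties are broken by `R`. -/
noncomputable def arrange (x : X) (t : X → Finset (Fin n)) (c : X → ℕ) (R : Profile n X) :
    Profile n X :=
  fun i => ((R i).sortBy c).sortBy fun y => if y = x then 1 else if i ∈ t y then 0 else 2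

theorem arrange_pref_base {x : X} {t : X → Finset (Fin n)} {c : X → ℕ} {R : Profile n X}
    {i : Fin n} {y : X} (hy : y ≠ x) : (arrange x t c R i).pref y x ↔ i ∈ t y := by
  simp only [arrange, StrongOrdering.sortBy_pref, if_neg hy, if_true]
  split_ifs <;> simp_all

theorem arrange_base_pref {x : X} {t : X → Finset (Fin n)} {c : X → ℕ} {R : Profile n X}
    {i : Fin n} {y : X} (hy : y ≠ x) : (arrange x t c R i).pref x y ↔ i ∉ t y := by
  rw [← arrange_pref_base (c := c) (R := R) hy, StrongOrdering.not_pref_iff _ hy]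

theorem arrange_pref {x : X} {t : X → Finset (Fin n)} {c : X → ℕ} {R : Profile n X}
    {i : Fin n} {y z : X} (hy : y ≠ x) (hz : z ≠ x) :
    (arrange x t c R i).pref y z ↔
      (i ∈ t y ∧ i ∉ t z) ∨ ((i ∈ t y ↔ i ∈ t z) ∧ (c y < c z ∨ c y = c z ∧ (R i).pref y z)) := by
  simp only [arrange, StrongOrdering.sortBy_pref, if_neg hy, if_neg hz]
  by_cases h1 : i ∈ t y <;> by_cases h2 : i ∈ t z <;> simp [h1, h2]

/-- Membership of `arrange x t c R` in `NP` has to be checked only for pairs of alternatives with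
nested sets of supporters: any other pair is ranked in both ways by the individuals who rank `x`
between the two alternatives. -/
theorem arrange_mem_NP {x : X} {t : X → Finset (Fin n)} {c : X → ℕ} {R : Profile n X}
    (ht : ∀ y, y ≠ x → (t y).Nonempty ∧ t y ≠ Finset.univ)
    (hc : ∀ y z, y ≠ x → z ≠ x → y ≠ z → t y ⊆ t z →
      ∃ i, (i ∈ t y ↔ i ∈ t z) ∧ (c y < c z ∨ c y = c z ∧ (R i).pref y z)) :
    arrange x t c R ∈ NP n X := by
  refine mem_NP_of_forall_exists fun y z hyz => ?_
  by_cases hy : y = x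
  · subst hy
    obtain ⟨i, hi⟩ := Finset.ssubset_univ_iff.2 (ht z hyz.symm).2 |> Finset.exists_of_ssubset
    exact ⟨i, (arrange_base_pref hyz.symm).2 hi.2⟩
  by_cases hz : z = x
  · subst hz
    obtain ⟨i, hi⟩ := (ht y hyz).1
    exact ⟨i, (arrange_pref_base hyz).2 hi⟩
  simp only [arrange_pref hy hz]
  by_cases hsub : t y ⊆ t z
  · obtain ⟨i, hi⟩ := hc y z hy hz hyz hsub
    exact ⟨i, Or.inr hi⟩
  · obtain ⟨i, hi, hi'⟩ := Finset.not_subset.1 hsub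
    exact ⟨i, Or.inl ⟨hi, hi'⟩⟩

/-- Any assignment of supporters that is neither empty nor full is realized in `NP`: if smaller sets
of supporters come first, then of two alternatives with nested sets of supporters the one with the
smaller set is ranked first by its supporters. -/
theorem arrange_card_mem_NP {x : X} {t : X → Finset (Fin n)} {R : Profile n X}
    (ht : ∀ y, y ≠ x → (t y).Nonempty ∧ t y ≠ Finset.univ) (hR : R ∈ NP n X) :
    arrange x t (fun y => (t y).card) R ∈ NP n X := by
  refine arrange_mem_NP ht fun y z hy _ hyz hsub => ?_
  by_cases heq : t y = t z
  · obtain ⟨i, hi⟩ := (hR y z hyz).1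
    exact ⟨i, by simp [heq, hi]⟩
  · obtain ⟨i, hi⟩ := (ht y hy).1
    exact ⟨i, by simp [hi, hsub hi], Or.inl (Finset.card_lt_card (hsub.ssubset_of_ne heq))⟩

theorem upperSet_proper {p : Profile n X} (hp : p ∈ NP n X) {x y : X} (hy : y ≠ x) :
    (upperSet p x y).Nonempty ∧ upperSet p x y ≠ Finset.univ := by
  obtain ⟨⟨i, hi⟩, j, hj⟩ := hp y x hy
  refine ⟨⟨i, mem_upperSet.2 hi⟩, fun h => ?_⟩
  exact (p j).asymm _ _ hj (mem_upperSet.1 (h ▸ Finset.mem_univ j))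

/-- Sorting a profile by numbers of supporters stays within `NP`, also halfway: the sorting only
reverses pairs in favour of the alternative with fewer supporters. -/
theorem piecewise_arrange_mem_NP {x : X} {p : Profile n X} (hp : p ∈ NP n X)
    (S : Finset (Fin n)) :
    S.piecewise (arrange x (upperSet p x) (fun y => (upperSet p x y).card) p) p ∈ NP n X ∧
    S.piecewise p (arrange x (upperSet p x) (fun y => (upperSet p x y).card) p) ∈ NP n X := by
  set q := arrange x (upperSet p x) (fun y => (upperSet p x y).card) p
  suffices H : ∀ y z, y ≠ z → ∃ i, (p i).pref y z ∧ (q i).pref y z by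
    constructor <;> refine mem_NP_of_forall_exists fun y z hyz => ?_ <;>
      obtain ⟨i, h1, h2⟩ := H y z hyz <;> refine ⟨i, ?_⟩ <;>
      by_cases hi : i ∈ S <;> simp [hi, h1, h2]
  intro y z hyz
  obtain ⟨i, hi⟩ := (hp y z hyz).1
  by_cases hy : y = x
  · subst hy
    refine ⟨i, hi, (arrange_base_pref hyz.symm).2 fun h => ?_⟩
    exact (p i).asymm _ _ hi (mem_upperSet.1 h)
  by_cases hz : z = x
  · subst hz
    exact ⟨i, hi, (arrange_pref_base hyz).2 (mem_upperSet.2 hi)⟩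
  by_cases hsub : upperSet p x y ⊆ upperSet p x z
  · refine ⟨i, hi, (arrange_pref hy hz).2 (Or.inr ⟨⟨fun h => hsub h, fun h => ?_⟩, ?_⟩)⟩
    · exact mem_upperSet.2 ((p i).trans _ _ _ hi (mem_upperSet.1 h))
    · rcases (Finset.card_le_card hsub).lt_or_eq with h | h
      · exact Or.inl h
      · exact Or.inr ⟨h, hi⟩
  · obtain ⟨j, hj, hj'⟩ := Finset.not_subset.1 hsub
    refine ⟨j, ?_, (arrange_pref hy hz).2 (Or.inl ⟨hj, hj'⟩)⟩
    rw [mem_upperSet] at hj hj'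
    exact (p j).trans _ _ _ hj (((p j).not_pref_iff hz).1 hj')

/-- Whether a strategy-proof rule selects `x` depends only on the sets of individuals who rank the
other alternatives above `x`. -/
theorem StrategyProof.eq_of_upperSet_eq (hn : 3 ≤ n) (hg : StrategyProof g) {x : X}
    {p p' : Profile n X} (hp : p ∈ NP n X) (hp' : p' ∈ NP n X)
    (hU : upperSet p x = upperSet p' x) (h : g ⟨p, hp⟩ = x) : g ⟨p', hp'⟩ = x := by
  set t := upperSet p x with ht
  have htp : ∀ y, y ≠ x → (t y).Nonempty ∧ t y ≠ Finset.univ := fun y hy => upperSet_proper hp hy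
  -- With the supporters and the key held fixed, the tie-breaking profile moves from `p` to `p'`.
  let s : Profile n X → Profile n X := arrange x t fun y => (t y).card
  have hs : ∀ {R}, R ∈ NP n X → s R ∈ NP n X := fun hR => arrange_card_mem_NP htp hR
  have hs_iff : ∀ R i y, ((s R) i).pref y x ↔ i ∈ t y := fun R i y => by
    by_cases hy : y = x
    · subst hy
      exact iff_of_false ((s R i).irrefl _) fun h => (p i).irrefl _ (mem_upperSet.1 h)
    · exact arrange_pref_base hy
  have h1 : g ⟨s p, hs hp⟩ = x := by
    refine hg.eq_of_piecewise (fun S => (piecewise_arrange_mem_NP hp S).1) (fun i y hy => ?_) hp _ h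
    exact mem_upperSet.1 ((hs_iff p i y).1 hy)
  have h2 : ∀ hR : p' ∈ NP n X, g ⟨s p', hs hR⟩ = x := by
    refine NP_connected hn (Φ := fun R => ∀ hR : R ∈ NP n X, g ⟨s R, hs hR⟩ = x)
      (fun k R R' hR hR' hv hx _ => ?_) hp hp' fun _ => h1
    refine hg.eq_of_isVariant (h := k) (fun i hi => ?_)
      (fun y hy => (hs_iff _ _ _).2 ((hs_iff _ _ _).1 hy)) (hx hR)
    simp only [s, arrange, hv i hi]
  refine hg.eq_of_piecewise (p := s p') (fun S => ?_) (fun i y hy => ?_) _ hp' (h2 hp')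
  · simpa only [s, hU] using (piecewise_arrange_mem_NP hp' S).2
  · exact (hs_iff _ _ _).2 (hU ▸ mem_upperSet.2 hy)

/-- A strategy-proof rule keeps selecting `x` if a single individual `h` ranks fewer alternatives
above `x`. There are profiles with the given sets of supporters that differ at `h` only: sort by the
number of supporters other than `h`, and let two individuals other than `h` break ties in opposite
ways. -/
theorem StrategyProof.eq_of_upperSet_erase (hn : 3 ≤ n) (hg : StrategyProof g) {x : X}
    {p p' : Profile n X} (hp : p ∈ NP n X) (hp' : p' ∈ NP n X) (h : Fin n)
    (hsub : ∀ y, upperSet p' x y ⊆ upperSet p x y)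
    (herase : ∀ y, (upperSet p' x y).erase h = (upperSet p x y).erase h)
    (hx : g ⟨p, hp⟩ = x) : g ⟨p', hp'⟩ = x := by
  obtain ⟨a, ha⟩ : ∃ a, a ∉ ({h} : Finset (Fin n)) := by
    by_contra! hall
    have := Finset.card_le_card (fun i _ => hall i : Finset.univ ⊆ {h})
    simp at this
    omega
  obtain ⟨b, hb⟩ : ∃ b, b ∉ ({h, a} : Finset (Fin n)) := by
    by_contra! hall
    have := (Finset.card_le_card (fun i _ => hall i : Finset.univ ⊆ {h, a})).trans
      Finset.card_le_two
    simp at this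
    omega
  simp only [Finset.mem_insert, Finset.mem_singleton, not_or] at ha hb
  let R : Profile n X := Function.update p b (p a).reverse
  let c : X → ℕ := fun y => ((upperSet p x y).erase h).card
  have key : ∀ q : Profile n X, q ∈ NP n X →
      (∀ y, (upperSet q x y).erase h = (upperSet p x y).erase h) →
      arrange x (upperSet q x) c R ∈ NP n X := by
    intro q hq hqe
    refine arrange_mem_NP (fun y hy => upperSet_proper hq hy) fun y z hy hz hyz hs => ?_
    have hc : ∀ y, c y = ((upperSet q x y).erase h).card := fun y => by rw [hqe]
    have hss := Finset.erase_subset_erase h hs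
    by_cases heq : (upperSet q x y).erase h = (upperSet q x z).erase h
    · -- Only `h` may rank `x` between `y` and `z`, and `a` and `b` break the tie in opposite ways.
      have hmem : ∀ i, i ≠ h → (i ∈ upperSet q x y ↔ i ∈ upperSet q x z) := fun i hi => by
        have := Finset.ext_iff.1 heq i
        simpa [hi] using this
      rcases (p a).complete y z hyz with hyz' | hyz'
      · exact ⟨a, hmem a ha, Or.inr ⟨by rw [hc, hc, heq], by
          simpa [R, Ne.symm hb.2] using hyz'⟩⟩
      · exact ⟨b, hmem b hb.1, Or.inr ⟨by rw [hc, hc, heq], by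
          simpa [R, StrongOrdering.reverse] using hyz'⟩⟩
    · have hlt : c y < c z := by
        rw [hc, hc]
        exact Finset.card_lt_card (hss.ssubset_of_ne heq)
      -- Any supporter of `y`, even `h`, also supports `z`, and ranks `y` first by the key.
      obtain ⟨i, hi⟩ := (upperSet_proper hq hy).1
      exact ⟨i, iff_of_true hi (hs hi), Or.inl hlt⟩
  have hA := key p hp fun _ => rfl
  have hA' := key p' hp' herase
  have hu : ∀ q : Profile n X, upperSet (arrange x (upperSet q x) c R) x = upperSet q x := by
    intro q
    ext y i
    rw [mem_upperSet]
    by_cases hy : y = x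
    · subst hy
      exact iff_of_false (StrongOrdering.irrefl _ _)
        fun h => (q i).irrefl _ (mem_upperSet.1 h)
    · exact arrange_pref_base hy
  have h1 := hg.eq_of_upperSet_eq hn hp hA (hu p).symm hx
  refine hg.eq_of_upperSet_eq hn hA' hp' (hu p') ?_
  refine hg.eq_of_isVariant (h := h) (fun i hi => ?_) (fun y hy => ?_) h1
  · have hmem : ∀ y, i ∈ upperSet p' x y ↔ i ∈ upperSet p x y := fun y => by
      have := Finset.ext_iff.1 (herase y) i
      simpa [hi] using this
    simp only [arrange, hmem]
  · rw [← mem_upperSet, hu] at hy ⊢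
    exact hsub y hy

/-- Monotonicity: a strategy-proof rule that selects `x` keeps selecting `x` if no alternative gains
a supporter against `x`. -/
theorem StrategyProof.monotone (hn : 3 ≤ n) (hg : StrategyProof g) {x : X}
    {p p' : Profile n X} (hp : p ∈ NP n X) (hp' : p' ∈ NP n X)
    (hU : ∀ i y, (p' i).pref y x → (p i).pref y x) (h : g ⟨p, hp⟩ = x) : g ⟨p', hp'⟩ = x := by
  -- The supporters against `x` once the individuals of `S` have switched.
  let t : Finset (Fin n) → X → Finset (Fin n) := fun S y =>
    {i | if i ∈ S then i ∈ upperSet p' x y else i ∈ upperSet p x y}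
  have hsub : ∀ y, upperSet p' x y ⊆ upperSet p x y := fun y i hi =>
    mem_upperSet.2 (hU i y (mem_upperSet.1 hi))
  have ht : ∀ S y, y ≠ x → (t S y).Nonempty ∧ t S y ≠ Finset.univ := by
    intro S y hy
    obtain ⟨i, hi⟩ := (upperSet_proper hp' hy).1
    refine ⟨⟨i, by simp [t, hi, hsub y hi]⟩, fun hh => (upperSet_proper hp hy).2 ?_⟩
    refine Finset.eq_univ_iff_forall.2 fun j => ?_
    have hj := Finset.eq_univ_iff_forall.1 hh j
    simp only [t, Finset.mem_filter, Finset.mem_univ, true_and] at hj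
    split_ifs at hj
    · exact hsub y hj
    · exact hj
  have key : ∀ S (q : Profile n X) (hq : q ∈ NP n X), upperSet q x = t S → g ⟨q, hq⟩ = x := by
    intro S
    induction S using Finset.induction_on with
    | empty =>
      intro q hq hqt
      refine hg.eq_of_upperSet_eq hn hp hq ?_ h
      rw [hqt]
      ext
      simp [t]
    | insert k S hk ih =>
      intro q hq hqt
      have hAu : upperSet (arrange x (t S) (fun y => (t S y).card) p) x = t S := by
        ext y i
        rw [mem_upperSet]
        by_cases hy : y = x
        · subst hy
          refine iff_of_false (StrongOrdering.irrefl _ _) fun h => ?_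
          simp [t, mem_upperSet, StrongOrdering.irrefl] at h
        · exact arrange_pref_base hy
      have hA := arrange_card_mem_NP (ht S) hp
      refine hg.eq_of_upperSet_erase hn hA hq k (fun y => ?_) (fun y => ?_) (ih _ hA hAu)
      · rw [hAu, hqt]
        intro i hi
        simp only [t, Finset.mem_filter, Finset.mem_univ, true_and, Finset.mem_insert] at hi ⊢
        have := @hsub y i
        split_ifs at hi ⊢ <;> grind
      · rw [hAu, hqt]
        ext i
        by_cases hik : i = k <;> simp [t, hik]
  refine key Finset.univ p' hp' ?_
  ext
  simp [t]

end Monotonicity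

/-! ### A common supporter of two alternatives -/

section Core

variable {n : ℕ} {X : Type*} {g : NP n X → X}

/-- Each `x` in the range of `g` is selected at a profile in which somebody ranks both `w` and `z`
above `x`. -/
theorem StrategyProof.exists_common_supporter (hn : 3 ≤ n) (hg : StrategyProof g) {x w z : X}
    (hxw : x ≠ w) (hxz : x ≠ z) (hwz : w ≠ z) (hx : ∃ p, g p = x) :
    ∃ p, g p = x ∧ ∃ i, (p.1 i).pref w x ∧ (p.1 i).pref z x := by
  classical
  by_contra! hno
  obtain ⟨⟨p, hp⟩, hpx⟩ := hx
  have hsup : ∀ y, ∃ i, y ≠ x → (p i).pref y x := fun y => by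
    by_cases hy : y = x
    · exact ⟨⟨0, by omega⟩, fun h => absurd hy h⟩
    · obtain ⟨i, hi⟩ := (hp y x hy).1
      exact ⟨i, fun _ => hi⟩
  -- By monotonicity it suffices to keep one supporter `a y` of each alternative `y`.
  choose a ha using hsup
  have hab : a w ≠ a z := fun h => hno ⟨p, hp⟩ hpx (a w) (ha w hxw.symm) (h ▸ ha z hxz.symm)
  obtain ⟨c, hc⟩ : ∃ c, c ∉ ({a w, a z} : Finset (Fin n)) := by
    by_contra! hall
    have := (Finset.card_le_card (fun i _ => hall i : Finset.univ ⊆ {a w, a z})).trans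
      Finset.card_le_two
    simp at this
    omega
  simp only [Finset.mem_insert, Finset.mem_singleton, not_or] at hc
  -- The keys of `F s t` below, in which individual `i` puts the other alternatives that it supports
  -- (key 0) above `x`, `w`, `z` and the rest (key 4) below. Among `x`, `w`, `z`, individual `a w`
  -- reports `w x z`, or `w z x` if `s` is true; `a z` reports `z x w`, or `z w x` if `t` is true;
  -- all others report `x w z`.
  let k : Bool → Bool → Fin n → X → ℕ := fun s t i y =>
    if y = x then (if i = a w then (if s then 3 else 2) else
      if i = a z then (if t then 3 else 2) else 1)
    else if y = w then (if i = a w then 1 else if i = a z then (if t then 2 else 3) else 2)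
    else if y = z then (if i = a w then (if s then 2 else 3) else if i = a z then 1 else 3)
    else if i = a y then 0 else 4
  let F : Bool → Bool → Profile n X := fun s t i => (p i).sortBy (k s t i)
  have hF : ∀ s t i y v, (F s t i).pref y v ↔
      k s t i y < k s t i v ∨ k s t i y = k s t i v ∧ (p i).pref y v := fun _ _ _ _ _ => Iff.rfl
  have hNP : ∀ s t, F s t ∈ NP n X := by
    intro s t
    refine mem_NP_of_forall_exists fun y v hyv => ?_
    simp only [hF]
    by_cases hy : y = x ∨ y = w ∨ y = z
    · by_cases hv : v = x ∨ v = w ∨ v = z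
      · rcases hy with rfl | rfl | rfl
        · exact ⟨c, Or.inl (by grind)⟩
        · exact ⟨a y, Or.inl (by grind)⟩
        · exact ⟨a y, Or.inl (by grind)⟩
      · by_cases hva : a v = a w
        · exact ⟨a z, Or.inl (by grind)⟩
        · exact ⟨a w, Or.inl (by grind)⟩
    · by_cases hv : a v = a y ∧ v ≠ x ∧ v ≠ w ∧ v ≠ z
      · obtain ⟨i, hi⟩ := (hp y v hyv).1
        exact ⟨i, Or.inr ⟨by grind, hi⟩⟩
      · exact ⟨a y, Or.inl (by grind)⟩
  have hvar_s : ∀ s t, IsVariant (a w) (F s t) (F (!s) t) := fun s t i hi => by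
    simp only [F, k, hi, if_false]
  have hvar_t : ∀ s t, IsVariant (a z) (F s t) (F s (!t)) := fun s t i hi => by
    simp only [F, k, hi, if_false]
  have hx0 : g ⟨F false false, hNP _ _⟩ = x := by
    refine hg.monotone hn hp (hNP _ _) (fun i y hy => ?_) hpx
    rw [hF] at hy
    have h1 := ha y
    have h2 := (p i).irrefl x
    grind
  have hw1 : g ⟨F false true, hNP _ _⟩ = w := by
    by_cases hne : g ⟨F false true, hNP _ _⟩ = x
    · refine absurd ?_ (hno _ hne (a z) ?_) <;> rw [hF] <;> grind
    · rw [← hx0] at hne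
      obtain ⟨h1, h2⟩ := hg.pref_of_isVariant (hvar_t false false) hne
      simp only [hx0, hF] at h1 h2
      have h3 := (p (a z)).asymm x (g ⟨F false true, hNP _ _⟩)
      grind
  have hz1 : g ⟨F true false, hNP _ _⟩ = z := by
    by_cases hne : g ⟨F true false, hNP _ _⟩ = x
    · refine absurd ?_ (hno _ hne (a w) ?_) <;> rw [hF] <;> grind
    · rw [← hx0] at hne
      obtain ⟨h1, h2⟩ := hg.pref_of_isVariant (hvar_s false false) hne
      simp only [hx0, hF] at h1 h2
      have h3 := (p (a w)).asymm x (g ⟨F true false, hNP _ _⟩)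
      grind
  have hw2 : g ⟨F true true, hNP _ _⟩ = w := by
    refine hg.eq_of_isVariant (hvar_s false true) (fun y hy => ?_) hw1
    simp only [hF] at hy ⊢
    grind
  have hz2 : g ⟨F true true, hNP _ _⟩ = z := by
    refine hg.eq_of_isVariant (hvar_t true false) (fun y hy => ?_) hz1
    simp only [hF] at hy ⊢
    grind
  exact hwz (hw2.symm.trans hz2)

end Core

/-! ### The induced rule -/

section Merging

variable {n : ℕ} {X : Type*} {w z : X}

/-- The alternative of `X` that stands for a given one of `X*`, with `w` in the role of `x*`. -/
def unmerge (w z : X) : Merged w z → X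
  | none => w
  | some a => a

theorem unmerge_injective : Function.Injective (unmerge w z) := by
  rintro (_ | a) (_ | b) h
  · rfl
  · exact absurd h.symm b.2.1
  · exact absurd h a.2.1
  · exact congrArg some (Subtype.ext h)

theorem merge_left : merge w z w = none := by simp [merge]

theorem merge_right : merge w z z = none := by simp [merge]

theorem merge_coe (a : Others w z) : merge w z a = some a := by simp [merge, a.2.1, a.2.2]

/-- Every assignment of supporters against `b` that is neither empty nor full is realized by a
profile of `NP` over `X*`. -/
theorem exists_merged_profile {p : Profile n X} (hp : p ∈ NP n X) {b : Merged w z}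
    {t : Merged w z → Finset (Fin n)} (ht : ∀ y, y ≠ b → (t y).Nonempty ∧ t y ≠ Finset.univ) :
    ∃ q ∈ NP n (Merged w z), ∀ i y, y ≠ b → ((q i).pref y b ↔ i ∈ t y) :=
  ⟨_, arrange_card_mem_NP (R := fun i => (p i).comap _ unmerge_injective) ht
    fun _ _ hxy => hp _ _ (unmerge_injective.ne hxy), fun _ _ hy => arrange_pref_base hy⟩

namespace IsSplitting

variable {p : Profile n (Merged w z)} {r : Profile n X}

theorem pref_left_iff (h : IsSplitting p r) (i : Fin n) (a : Others w z) :
    (r i).pref a w ↔ (p i).pref (some a) none :=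
  Set.ext_iff.1 (h.2.2 i) a

theorem left_pref_iff (h : IsSplitting p r) (i : Fin n) (a : Others w z) :
    (r i).pref w a ↔ (p i).pref none (some a) := by
  rw [← (r i).not_pref_iff a.2.1, h.pref_left_iff, (p i).not_pref_iff (by simp)]

theorem right_pref_iff (h : IsSplitting p r) (i : Fin n) (a : Others w z) :
    (r i).pref z a ↔ (p i).pref none (some a) := by
  rw [← h.left_pref_iff]
  have h1 := h.1.2 i
  simp only [Contiguous, not_exists, not_or, not_and] at h1
  obtain ⟨h2, h3⟩ := h1 a
  constructor <;> intro h'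
  · exact ((r i).not_pref_iff a.2.1).1 (h3 h')
  · exact ((r i).not_pref_iff a.2.2).1 (h2 h')

end IsSplitting

variable {g : NP n X → X}

theorem inducedRule_eq_some {r : (p : NP n (Merged w z)) → {r : Profile n X // IsSplitting p.1 r}}
    (hn : 3 ≤ n) (hg : StrategyProof g) (hrange : FullRange g) (hwz : w ≠ z) (x : Others w z) :
    ∃ p, inducedRule g r p = some x := by
  obtain ⟨q, hqx, k, hkw, hkz⟩ := hg.exists_common_supporter hn x.2.1 x.2.2 hwz
    (Set.range_eq_univ.1 hrange x)
  obtain ⟨p, hp, hpt⟩ := exists_merged_profile (w := w) (z := z) (b := some x)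
    (t := fun y => y.elim {k} fun a => upperSet q.1 x a) q.2 (by
      rintro (_ | a) ha
      · refine ⟨⟨k, by simp⟩, fun h => ?_⟩
        have := congrArg Finset.card h
        simp at this
        omega
      · exact upperSet_proper q.2 fun h => ha (congrArg some (Subtype.ext h)))
  have hr := (r ⟨p, hp⟩).2
  refine ⟨⟨p, hp⟩, ?_⟩
  rw [← merge_coe, inducedRule]
  congr 1
  refine hg.monotone hn q.2 _ (fun i y hy => ?_) hqx
  by_cases hyw : y = w
  · subst hyw
    rw [hr.left_pref_iff, hpt _ _ (by simp)] at hy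
    rwa [Finset.mem_singleton.1 hy]
  by_cases hyz : y = z
  · subst hyz
    rw [hr.right_pref_iff, hpt _ _ (by simp)] at hy
    rwa [Finset.mem_singleton.1 hy]
  · by_cases hyx : y = x
    · subst hyx
      exact absurd hy (StrongOrdering.irrefl _ _)
    · rw [hr.2.1 i ⟨y, hyw, hyz⟩ x, hpt _ _ (by simpa [Subtype.ext_iff] using hyx)] at hy
      exact mem_upperSet.1 hy

theorem inducedRule_eq_none {r : (p : NP n (Merged w z)) → {r : Profile n X // IsSplitting p.1 r}}
    (hn : 3 ≤ n) (hg : StrategyProof g) (hrange : FullRange g) :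
    ∃ p, inducedRule g r p = none := by
  obtain ⟨q, hqw⟩ := Set.range_eq_univ.1 hrange w
  obtain ⟨p, hp, hpt⟩ := exists_merged_profile (w := w) (z := z) (b := none)
    (t := fun y => y.elim ∅ fun a => upperSet q.1 w a) q.2 (by
      rintro (_ | a) ha
      · exact absurd rfl ha
      · exact upperSet_proper q.2 a.2.1)
  have hr := (r ⟨p, hp⟩).2
  refine ⟨⟨p, hp⟩, ?_⟩
  by_contra hne
  obtain ⟨x, hx⟩ := Option.ne_none_iff_exists'.1 hne
  have hgx : g ⟨_, hr.1.1⟩ = x := by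
    rw [inducedRule, ← merge_coe] at hx
    have := merge_eq hx
    have := x.2
    tauto
  -- The splitting of `p` that ranks `w` and `z` as `q` does.
  let s : Profile n X := fun i => (p i).lex (merge w z) (q.1 i)
  have hs : ∀ i a b, (s i).pref a b ↔
      (p i).pref (merge w z a) (merge w z b) ∨ merge w z a = merge w z b ∧ (q.1 i).pref a b :=
    fun _ _ _ => Iff.rfl
  have hsNP : s ∈ NP n X := mem_NP_of_forall_exists fun a b hab => by
    by_cases h : merge w z a = merge w z b
    · obtain ⟨i, hi⟩ := (q.2 a b hab).1
      exact ⟨i, Or.inr ⟨h, hi⟩⟩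
    · obtain ⟨i, hi⟩ := (hp _ _ h).1
      exact ⟨i, Or.inl hi⟩
  have hsw : g ⟨s, hsNP⟩ = w := by
    refine hg.monotone hn q.2 hsNP (fun i y hy => ?_) hqw
    rw [hs, merge_left] at hy
    rcases hy with hy | hy
    · by_cases hyo : y ≠ w ∧ y ≠ z
      · rw [merge_coe ⟨y, hyo⟩, hpt _ _ (by simp)] at hy
        exact mem_upperSet.1 hy
      · rw [merge, dif_neg hyo] at hy
        exact absurd hy (StrongOrdering.irrefl _ _)
    · exact hy.2
  have hsx : g ⟨s, hsNP⟩ = x := by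
    refine hg.monotone hn hr.1.1 hsNP (fun i y hy => ?_) hgx
    rw [hs, merge_coe] at hy
    rcases hy with hy | hy
    · by_cases hyw : y = w
      · subst hyw
        rwa [hr.left_pref_iff, ← merge_left (w := y) (z := z)]
      by_cases hyz : y = z
      · subst hyz
        rwa [hr.right_pref_iff, ← merge_right (w := w) (z := y)]
      · rw [merge_coe ⟨y, hyw, hyz⟩] at hy
        exact (hr.2.1 i ⟨y, hyw, hyz⟩ x).2 hy
    · have := merge_eq (hy.1.trans (merge_coe x).symm)
      have hyx : y = x := by
        have := x.2
        tauto
      exact absurd hy.2 (hyx ▸ StrongOrdering.irrefl _ _)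
  exact x.2.1 (hsx.symm.trans hsw)

end Merging

theorem mainTheorem2 (n m : ℕ) (hn : 3 ≤ n) (hm : 3 ≤ m)
    {X : Type*} [Fintype X] (hX : Fintype.card X = m + 1)
    (g : NP n X → X) (hg : StrategyProof g) (hrange : FullRange g)
    (w z : X) (hwz : w ≠ z)
    (r : (p : NP n (Merged w z)) → {r : Profile n X // IsSplitting p.1 r}) :
    FullRange (inducedRule g r) := by
  refine Set.range_eq_univ.2 ?_
  rintro (_ | x)
  · exact inducedRule_eq_none hn hg hrange
  · exact inducedRule_eq_some hn hg hrange hwz x
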